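/- Let $0<\mu<1$, and let $S_\mu$ and $S'_\mu$ be two independent positive stable random variables with exponent $\mu$, i.e. nonnegative random variables, each with Laplace transform $$E[\exp(-\lambda S_\mu)]=E[\exp(-\lambda S'_\mu)]=\exp(-\lambda^\mu)\qquad\text{for every }\lambda\ge 0 .$$ Then the law of the random variable $$A=\frac{S'_\mu}{S'_\mu+S_\mu}$$ is absolutely continuous with respect to Lebesgue measure on $\mathbb{R}$; it is concentrated on $[0,1]$, and its density there is $$P(A\in dz)=\frac{\sin(\pi\mu)}{\pi}\,\frac{dz}{z(1-z)\left[\left(\frac{1-z}{z}\right)^{\mu}+\left(\frac{z}{1-z}\right)^{\mu}+2\cos(\pi\mu)\right]},\qquad z\in[0,1]$$ (the values at the two endpoints, which form a null set, being immaterial). -/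

import Mathlib

open MeasureTheory ProbabilityTheory

/-- `S` is a (one-sided, normalized) stable random variable with exponent `μ`: it is almost surely
nonnegative and its Laplace transform is `E[exp (-t S)] = exp (-t ^ μ)` for all `t ≥ 0`.
(Almost sure strict positivity is a consequence when `0 < μ`, by letting `t → ∞`.) -/
structure IsPositiveStable {Ω : Type*} [MeasurableSpace Ω] (P : Measure Ω) (μ : ℝ) (S : Ω → ℝ) :
    Prop where
  aemeasurable : AEMeasurable S P
  nonneg : ∀ᵐ ω ∂P, 0 ≤ S ω
  laplace : ∀ t : ℝ, 0 ≤ t → ∫ ω, Real.exp (-(t * S ω)) ∂P = Real.exp (-(t ^ μ))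

/-- The explicit density on `[0,1]` (its values at the endpoints are irrelevant). -/
noncomputable def stableRatioDensity (μ z : ℝ) : ℝ :=
  Real.sin (Real.pi * μ) / Real.pi *
    (1 / (z * (1 - z) *
      (((1 - z) / z) ^ μ + (z / (1 - z)) ^ μ + 2 * Real.cos (Real.pi * μ))))

open Filter Topology

/-! The law of `A` and the candidate measure are compared through a weighted Stieltjes transform,
the integral of (1 - z) / (1 - w z) for small real w.

Probabilistic side: with x = 1 - w, (1 - A) / (1 - w A) = S / (S + x S'). Writing 1 / (S + x S') as
the integral of exp(-t (S + x S')) over t > 0 and using independence, the expectation becomes the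
integral of μ t^(μ-1) exp(-(1 + x^μ) t^μ), which is 1 / (1 + x^μ)
(`IsPositiveStable.integral_div_add`). The numerator S is what produces the factor t^(μ-1), through
the derivative of the Laplace transform.

Analytic side: the substitution z = 1 / (1 + e^u) turns the transform of the density into the
integral of `logKernel` with e^a = 1 - w. Up to the factor 2i sin(πμ), `logKernel` is the difference
between the lower and upper boundary values on |Im w| ≤ π of a function holomorphic there,
`stripKernel`. Cauchy's theorem on long rectangles leaves only the limit at the right end, and this
gives 1 / (1 + e^(μa)) = 1 / (1 + x^μ) again (`logKernel_integral`).

A finite measure on [0,1] is determined by its Stieltjes transform near 0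
(`ext_of_integral_inv_one_sub_eq`), so the two measures agree after multiplication by 1 - z. Both
are carried by [0,1), where this weight is positive and can be divided out. -/

/-! ### A holomorphic kernel on the strip |Im w| ≤ π. -/

theorem one_add_cexp_ne_zero {w : ℂ} (hw : |w.im| < Real.pi) : 1 + Complex.exp w ≠ 0 := by
  intro h
  have h1 : Complex.exp w = Complex.exp (Real.pi * Complex.I) := by
    rw [Complex.exp_pi_mul_I]; linear_combination h
  obtain ⟨n, hn⟩ := Complex.exp_eq_exp_iff_exists_int.1 h1
  have h2 : w.im = Real.pi + n * (2 * Real.pi) := by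
    have := congrArg Complex.im hn
    simpa using this
  have hpi := Real.pi_pos
  rw [h2, abs_lt] at hw
  have h3 : (-1 : ℝ) < n := by nlinarith
  have h4 : (n : ℝ) < 0 := by nlinarith
  have h5 : (-1 : ℤ) < n := by exact_mod_cast h3
  have h6 : n < 0 := by exact_mod_cast h4
  omega

theorem cexp_ne_cexp_ofReal {w : ℂ} {a : ℝ} (hw : |w.im| ≤ Real.pi) (hne : w ≠ a) :
    Complex.exp w ≠ Complex.exp a := by
  intro h
  obtain ⟨n, hn⟩ := Complex.exp_eq_exp_iff_exists_int.1 h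
  have h2 : w.im = n * (2 * Real.pi) := by
    have := congrArg Complex.im hn
    simpa using this
  have hpi := Real.pi_pos
  rw [h2, abs_le] at hw
  have h3 : (-1 : ℝ) < n := by nlinarith
  have h4 : (n : ℝ) < 1 := by nlinarith
  have h5 : (-1 : ℤ) < n := by exact_mod_cast h3
  have h6 : n < 1 := by exact_mod_cast h4
  obtain rfl : n = 0 := by omega
  apply hne
  simpa using hn

/-- The function `(1 / (1 + e ^ (μ w)) - 1 / (1 + e ^ (μ a))) * e ^ w / (e ^ w - e ^ a)`, with its
removable singularity at `a` filled in. -/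
noncomputable def stripKernel (μ a : ℝ) (w : ℂ) : ℂ :=
  -(Complex.exp w * (dslope (fun v : ℂ => Complex.exp (μ * v)) a w / dslope Complex.exp a w)) /
    ((1 + Complex.exp (μ * w)) * (1 + Complex.exp (μ * a)))

theorem one_add_cexp_mul_ne_zero {μ : ℝ} (hμ0 : 0 < μ) (hμ1 : μ < 1) {w : ℂ}
    (hw : |w.im| ≤ Real.pi) : 1 + Complex.exp (μ * w) ≠ 0 := by
  apply one_add_cexp_ne_zero
  rw [Complex.im_ofReal_mul, abs_mul, abs_of_pos hμ0]
  have := Real.pi_pos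
  nlinarith [abs_nonneg w.im]

/-- The difference of reciprocals equals -(e^(μw) - e^(μa)) over the product of denominators. The
factors w - a hidden in the two divided differences cancel. -/
theorem stripKernel_eq {μ a : ℝ} (hμ0 : 0 < μ) (hμ1 : μ < 1) {w : ℂ} (hw : |w.im| ≤ Real.pi)
    (hne : w ≠ a) : stripKernel μ a w =
      (1 / (1 + Complex.exp (μ * w)) - 1 / (1 + Complex.exp (μ * a))) *
        (Complex.exp w / (Complex.exp w - Complex.exp a)) := by
  have h1 := one_add_cexp_mul_ne_zero hμ0 hμ1 hw
  have h2 : 1 + Complex.exp (μ * a) ≠ 0 :=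
    one_add_cexp_mul_ne_zero hμ0 hμ1 (by simp [Real.pi_pos.le])
  have h3 := sub_ne_zero.2 (cexp_ne_cexp_ofReal hw hne)
  have h4 := sub_ne_zero.2 hne
  rw [stripKernel, dslope_of_ne _ hne, dslope_of_ne _ hne, slope_def_field, slope_def_field]
  field_simp
  ring

/-- In the closed strip e^w = e^a only at w = a, where the divided difference of exp is e^a ≠ 0.
Since μ < 1, 1 + e^(μw) has no zero there either. -/
theorem differentiableAt_stripKernel {μ a : ℝ} (hμ0 : 0 < μ) (hμ1 : μ < 1) {w : ℂ}
    (hw : |w.im| ≤ Real.pi) : DifferentiableAt ℂ (stripKernel μ a) w := by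
  have key : ∀ f : ℂ → ℂ, Differentiable ℂ f → DifferentiableAt ℂ (dslope f a) w := by
    intro f hf
    exact ((Complex.differentiableOn_dslope Filter.univ_mem).2 hf.differentiableOn).differentiableAt
      Filter.univ_mem
  have h2 : 1 + Complex.exp (μ * a) ≠ 0 :=
    one_add_cexp_mul_ne_zero hμ0 hμ1 (by simp [Real.pi_pos.le])
  have h5 : dslope Complex.exp a w ≠ 0 := by
    by_cases hne : w = a
    · rw [hne, dslope_same]; simp
    · rw [dslope_of_ne _ hne, slope_def_field]
      exact div_ne_zero (sub_ne_zero.2 (cexp_ne_cexp_ofReal hw hne)) (sub_ne_zero.2 hne)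
  unfold stripKernel
  refine DifferentiableAt.div (DifferentiableAt.neg (DifferentiableAt.mul (by fun_prop)
    (DifferentiableAt.div (key _ (by fun_prop)) (key _ (by fun_prop)) h5))) (by fun_prop)
    (mul_ne_zero (one_add_cexp_mul_ne_zero hμ0 hμ1 hw) h2)

/-! ### The density in logarithmic coordinates, as a jump across the strip. -/

theorem inv_add_self_add_two_cos_pos {μ : ℝ} (hμ0 : 0 < μ) (hμ1 : μ < 1) {r : ℝ} (hr : 0 < r) :
    0 < r⁻¹ + r + 2 * Real.cos (Real.pi * μ) := by
  have hs : 0 < Real.sin (Real.pi * μ) :=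
    Real.sin_pos_of_pos_of_lt_pi (by have := Real.pi_pos; positivity)
      (by nlinarith [Real.pi_pos])
  have h1 := Real.sin_sq_add_cos_sq (Real.pi * μ)
  have h2 : -1 < Real.cos (Real.pi * μ) := by nlinarith [sq_pos_of_pos hs]
  have h3 : 2 ≤ r⁻¹ + r := by
    have : r⁻¹ + r - 2 = (r - 1) ^ 2 / r := by field_simp; ring
    have h4 : 0 ≤ (r - 1) ^ 2 / r := by positivity
    linarith
  linarith

/-- The logarithmic form of the density, times the Stieltjes kernel. -/
noncomputable def logKernel (μ a u : ℝ) : ℝ :=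
  1 / ((Real.exp (μ * u))⁻¹ + Real.exp (μ * u) + 2 * Real.cos (Real.pi * μ)) *
    (Real.exp u / (Real.exp u + Real.exp a))

theorem logKernel_nonneg {μ : ℝ} (hμ0 : 0 < μ) (hμ1 : μ < 1) (a u : ℝ) : 0 ≤ logKernel μ a u := by
  have := inv_add_self_add_two_cos_pos hμ0 hμ1 (Real.exp_pos (μ * u))
  unfold logKernel
  positivity

theorem continuous_logKernel {μ : ℝ} (hμ0 : 0 < μ) (hμ1 : μ < 1) (a : ℝ) :
    Continuous (logKernel μ a) := by
  unfold logKernel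
  refine Continuous.mul (Continuous.div continuous_const ?_ ?_) (Continuous.div (by fun_prop)
    (by fun_prop) ?_)
  · refine Continuous.add (Continuous.add (Continuous.inv₀ (by fun_prop) ?_) (by fun_prop))
      (by fun_prop)
    exact fun u => (Real.exp_pos _).ne'
  · exact fun u => (inv_add_self_add_two_cos_pos hμ0 hμ1 (Real.exp_pos (μ * u))).ne'
  · exact fun u => by positivity

/-- On both edges e^w = -e^u, so the factor e^w / (e^w - e^a) is common and the constant 1 / (1 +
e^(μa)) cancels. Only the multivalued part 1 / (1 + e^(μw)) contributes. -/
theorem stripKernel_sub {μ : ℝ} (hμ0 : 0 < μ) (hμ1 : μ < 1) (a u : ℝ) :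
    stripKernel μ a (u + (-Real.pi : ℝ) * Complex.I) - stripKernel μ a (u + Real.pi * Complex.I) =
      2 * Complex.I * Real.sin (Real.pi * μ) * logKernel μ a u := by
  have hpi := Real.pi_pos
  have hi1 : |((u : ℂ) + (-Real.pi : ℝ) * Complex.I).im| ≤ Real.pi := by
    simp [abs_of_pos hpi]
  have hi2 : |((u : ℂ) + Real.pi * Complex.I).im| ≤ Real.pi := by
    simp [abs_of_pos hpi]
  have hn1 : (u : ℂ) + (-Real.pi : ℝ) * Complex.I ≠ a := by
    intro h
    have := congrArg Complex.im h
    simp at this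
  have hn2 : (u : ℂ) + Real.pi * Complex.I ≠ a := by
    intro h
    have := congrArg Complex.im h
    simp at this
  have g1 := one_add_cexp_mul_ne_zero hμ0 hμ1 hi1
  have g2 := one_add_cexp_mul_ne_zero hμ0 hμ1 hi2
  rw [stripKernel_eq hμ0 hμ1 hi1 hn1, stripKernel_eq hμ0 hμ1 hi2 hn2]
  have e1 : Complex.exp ((u : ℂ) + (-Real.pi : ℝ) * Complex.I) = -Complex.exp u := by
    rw [Complex.exp_add]
    have : ((-Real.pi : ℝ) : ℂ) * Complex.I = -(Real.pi * Complex.I) := by push_cast; ring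
    rw [this, Complex.exp_neg, Complex.exp_pi_mul_I]; norm_num
  have e2 : Complex.exp ((u : ℂ) + Real.pi * Complex.I) = -Complex.exp u := by
    rw [Complex.exp_add, Complex.exp_pi_mul_I]; ring
  set c : ℂ := Complex.cos (Real.pi * μ) with hc
  set s : ℂ := Complex.sin (Real.pi * μ) with hs
  have hcs : s ^ 2 + c ^ 2 = 1 := Complex.sin_sq_add_cos_sq _
  have hI : Complex.I ^ 2 = -1 := Complex.I_sq
  have e3 : Complex.exp (μ * ((u : ℂ) + (-Real.pi : ℝ) * Complex.I)) =
      Complex.exp (μ * u) * (c - s * Complex.I) := by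
    have : (μ : ℂ) * ((u : ℂ) + (-Real.pi : ℝ) * Complex.I) =
      μ * u + (-(Real.pi * μ)) * Complex.I := by push_cast; ring
    rw [this, Complex.exp_add, Complex.exp_mul_I, Complex.cos_neg, Complex.sin_neg]
    ring
  have e4 : Complex.exp (μ * ((u : ℂ) + Real.pi * Complex.I)) =
      Complex.exp (μ * u) * (c + s * Complex.I) := by
    have : (μ : ℂ) * ((u : ℂ) + Real.pi * Complex.I) =
      μ * u + (Real.pi * μ) * Complex.I := by ring
    rw [this, Complex.exp_add, Complex.exp_mul_I]
  rw [e3] at g1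
  rw [e4] at g2
  rw [e1, e2, e3, e4]
  have k1 : -Complex.exp u - Complex.exp a ≠ 0 := by
    have : -Complex.exp u - Complex.exp a = ((-(Real.exp u + Real.exp a) : ℝ) : ℂ) := by
      push_cast; ring
    rw [this]
    exact_mod_cast (neg_neg_of_pos (by positivity : 0 < Real.exp u + Real.exp a)).ne
  have k1' : Complex.exp u + Complex.exp a ≠ 0 := by
    intro h; apply k1; linear_combination -h
  have k2 := Complex.exp_ne_zero (μ * u)
  have k3 := inv_add_self_add_two_cos_pos hμ0 hμ1 (Real.exp_pos (μ * u))
  have k4 : (Complex.exp (μ * u))⁻¹ + Complex.exp (μ * u) + 2 * c ≠ 0 := by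
    have := Complex.ofReal_ne_zero.2 k3.ne'
    push_cast at this
    exact this
  -- With r = e^(μu), the product of the two conjugate factors is 1 + 2cr + r², from which r is
  -- pulled out.
  have k5 : (1 + Complex.exp (μ * u) * (c - s * Complex.I)) *
      (1 + Complex.exp (μ * u) * (c + s * Complex.I)) =
      Complex.exp (μ * u) * ((Complex.exp (μ * u))⁻¹ + Complex.exp (μ * u) + 2 * c) := by
    linear_combination Complex.exp (μ * u) ^ 2 * hcs - Complex.exp (μ * u) ^ 2 * s ^ 2 * hI -
      mul_inv_cancel₀ k2
  have k6 : 1 / (1 + Complex.exp (μ * u) * (c - s * Complex.I)) -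
      1 / (1 + Complex.exp (μ * u) * (c + s * Complex.I)) =
      2 * Complex.I * s / ((Complex.exp (μ * u))⁻¹ + Complex.exp (μ * u) + 2 * c) := by
    rw [div_sub_div _ _ g1 g2, k5, div_eq_div_iff (mul_ne_zero k2 k4) k4]
    ring
  have k7 : ((logKernel μ a u : ℝ) : ℂ) =
      1 / ((Complex.exp (μ * u))⁻¹ + Complex.exp (μ * u) + 2 * c) *
        (Complex.exp u / (Complex.exp u + Complex.exp a)) := by
    rw [logKernel]; push_cast; rfl
  have k8 : -Complex.exp u / (-Complex.exp u - Complex.exp a) =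
      Complex.exp u / (Complex.exp u + Complex.exp a) := by
    field_simp; ring
  rw [k8, ← sub_mul, sub_sub_sub_cancel_right, k6, k7]
  have : ((Real.sin (Real.pi * μ) : ℝ) : ℂ) = s := by rw [hs]; push_cast; rfl
  rw [this]
  ring

/-! ### Limits along the vertical edges. -/

/-- Far to the left e^w / (e^w - e^a) is exponentially small while the other factor stays bounded.
The bound is uniform in y. -/
theorem norm_stripKernel_left_le {μ a T y : ℝ} (hμ0 : 0 < μ) (hμ1 : μ < 1) (hT0 : 0 < T)
    (hTa : -a < T) (hy : |y| ≤ Real.pi) :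
    ‖stripKernel μ a ((-T : ℝ) + y * Complex.I)‖ ≤
      (1 / (1 - Real.exp (-(μ * T))) + 1) *
        (Real.exp (-T - a) / (1 - Real.exp (-T - a))) := by
  have hne : ((-T : ℝ) : ℂ) + y * Complex.I ≠ a := by
    intro h
    have := congrArg Complex.re h
    simp at this
    linarith
  rw [stripKernel_eq hμ0 hμ1 (by simpa using hy) hne, norm_mul]
  have hp : Real.exp (-(μ * T)) < 1 := Real.exp_lt_one_iff.2 (by have := mul_pos hμ0 hT0; linarith)
  have hq : Real.exp (-T - a) < 1 := Real.exp_lt_one_iff.2 (by linarith)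
  have n1 : ‖Complex.exp (μ * (((-T : ℝ) : ℂ) + y * Complex.I))‖ = Real.exp (-(μ * T)) := by
    rw [Complex.norm_exp]; simp
  have n2 : ‖Complex.exp (((-T : ℝ) : ℂ) + y * Complex.I)‖ = Real.exp (-T) := by
    rw [Complex.norm_exp]; simp
  have n3 : ‖Complex.exp (a : ℂ)‖ = Real.exp a := by
    rw [Complex.norm_exp]; simp
  gcongr
  · refine (norm_sub_le _ _).trans (add_le_add ?_ ?_)
    · rw [norm_div, norm_one]
      refine one_div_le_one_div_of_le (by linarith) ?_
      have := norm_sub_norm_le (1 : ℂ) (-Complex.exp (μ * (((-T : ℝ) : ℂ) + y * Complex.I)))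
      rw [norm_neg, n1, norm_one, sub_neg_eq_add] at this
      exact this
    · have h : (1 : ℂ) / (1 + Complex.exp (μ * a)) = ((1 / (1 + Real.exp (μ * a)) : ℝ) : ℂ) := by
        push_cast; rfl
      have hp := Real.exp_pos (μ * a)
      rw [h, Complex.norm_real, Real.norm_of_nonneg (by positivity), div_le_one (by positivity)]
      linarith
  · rw [norm_div, n2]
    have h : Real.exp (-T - a) / (1 - Real.exp (-T - a)) =
        Real.exp (-T) / (Real.exp a - Real.exp (-T)) := by
      rw [Real.exp_sub] at hq ⊢
      have := Real.exp_pos a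
      have h2 : Real.exp (-T) < Real.exp a := Real.exp_lt_exp.2 (by linarith)
      rw [div_eq_div_iff (by linarith) (by linarith)]
      field_simp
    have h2 : Real.exp (-T) < Real.exp a := Real.exp_lt_exp.2 (by linarith)
    rw [h]
    refine div_le_div_of_nonneg_left (Real.exp_pos _).le (by linarith) ?_
    have := norm_sub_norm_le (Complex.exp (a : ℂ)) (Complex.exp (((-T : ℝ) : ℂ) + y * Complex.I))
    rw [n2, n3, norm_sub_rev] at this
    exact this

/-- Far to the right 1 / (1 + e^(μw)) tends to 0 and e^w / (e^w - e^a) tends to 1, so the kernel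
tends to the subtracted constant, with its minus sign. -/
theorem norm_stripKernel_add_right_le {μ a T y : ℝ} (hμ0 : 0 < μ) (hμ1 : μ < 1) (hT0 : 0 < T)
    (hTa : a < T) (hy : |y| ≤ Real.pi) :
    ‖stripKernel μ a (T + y * Complex.I) + 1 / (1 + Complex.exp (μ * a))‖ ≤
      Real.exp (-(μ * T)) / (1 - Real.exp (-(μ * T))) * (1 / (1 - Real.exp (a - T))) +
        Real.exp (a - T) / (1 - Real.exp (a - T)) := by
  have hne : (T : ℂ) + y * Complex.I ≠ a := by
    intro h
    have := congrArg Complex.re h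
    simp at this
    linarith
  have him : |((T : ℂ) + y * Complex.I).im| ≤ Real.pi := by simpa using hy
  have k1 := sub_ne_zero.2 (cexp_ne_cexp_ofReal him hne)
  have hp : Real.exp (-(μ * T)) < 1 := Real.exp_lt_one_iff.2 (by have := mul_pos hμ0 hT0; linarith)
  have hq : Real.exp (a - T) < 1 := Real.exp_lt_one_iff.2 (by linarith)
  have n1 : ‖Complex.exp (μ * ((T : ℂ) + y * Complex.I))‖ = Real.exp (μ * T) := by
    rw [Complex.norm_exp]; simp
  have n2 : ‖Complex.exp ((T : ℂ) + y * Complex.I)‖ = Real.exp T := by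
    rw [Complex.norm_exp]; simp
  have n3 : ‖Complex.exp (a : ℂ)‖ = Real.exp a := by
    rw [Complex.norm_exp]; simp
  have h2 : Real.exp a < Real.exp T := Real.exp_lt_exp.2 hTa
  have h1 : 1 < Real.exp (μ * T) := Real.one_lt_exp_iff.2 (mul_pos hμ0 hT0)
  have n4 : Real.exp T - Real.exp a ≤
      ‖Complex.exp ((T : ℂ) + y * Complex.I) - Complex.exp (a : ℂ)‖ := by
    have := norm_sub_norm_le (Complex.exp ((T : ℂ) + y * Complex.I)) (Complex.exp (a : ℂ))
    rwa [n2, n3] at this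
  rw [stripKernel_eq hμ0 hμ1 him hne]
  set E := Complex.exp ((T : ℂ) + y * Complex.I)
  set F := 1 / (1 + Complex.exp (μ * ((T : ℂ) + y * Complex.I))) with hF
  set c := (1 : ℂ) / (1 + Complex.exp (μ * a)) with hc
  -- Since E / (E - e^a) = 1 + e^a / (E - e^a), adding c leaves two terms that are both small.
  have e : (F - c) * (E / (E - Complex.exp a)) + c =
      F * (E / (E - Complex.exp a)) + -c * (Complex.exp a / (E - Complex.exp a)) := by
    field_simp
    ring
  rw [e]
  refine (norm_add_le _ _).trans (add_le_add ?_ ?_)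
  · rw [norm_mul]
    gcongr
    · rw [hF, norm_div, norm_one]
      have h : Real.exp (-(μ * T)) / (1 - Real.exp (-(μ * T))) = 1 / (Real.exp (μ * T) - 1) := by
        rw [Real.exp_neg] at hp ⊢
        rw [div_eq_div_iff (by linarith) (by linarith)]
        field_simp
      rw [h]
      refine one_div_le_one_div_of_le (by linarith) ?_
      have := norm_sub_norm_le (Complex.exp (μ * ((T : ℂ) + y * Complex.I))) (-1)
      rw [norm_neg, n1, norm_one, sub_neg_eq_add, add_comm (Complex.exp _)] at this
      exact this
    · rw [norm_div, n2]
      have h : 1 / (1 - Real.exp (a - T)) = Real.exp T / (Real.exp T - Real.exp a) := by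
        rw [Real.exp_sub] at hq ⊢
        rw [div_eq_div_iff (by linarith) (by linarith)]
        field_simp
      rw [h]
      exact div_le_div_of_nonneg_left (Real.exp_pos _).le (by linarith) n4
  · rw [norm_mul, norm_neg, norm_div (Complex.exp _), n3]
    have h : Real.exp (a - T) / (1 - Real.exp (a - T)) =
        Real.exp a / (Real.exp T - Real.exp a) := by
      rw [Real.exp_sub] at hq ⊢
      rw [div_eq_div_iff (by linarith) (by linarith)]
      field_simp
    have h' : c = ((1 / (1 + Real.exp (μ * a)) : ℝ) : ℂ) := by
      rw [hc]; push_cast; rfl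
    have hp := Real.exp_pos (μ * a)
    have h5 : ‖c‖ ≤ 1 := by
      rw [h', Complex.norm_real, Real.norm_of_nonneg (by positivity), div_le_one (by positivity)]
      linarith
    rw [h]
    calc _ ≤ 1 * (Real.exp a / (Real.exp T - Real.exp a)) := by
          gcongr
      _ = _ := one_mul _

theorem tendsto_integral_stripKernel_left {μ : ℝ} (hμ0 : 0 < μ) (hμ1 : μ < 1) (a : ℝ) :
    Tendsto (fun T : ℝ => ∫ y : ℝ in (-Real.pi)..Real.pi,
      stripKernel μ a ((-T : ℝ) + y * Complex.I)) atTop (𝓝 0) := by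
  have hpi := Real.pi_pos
  have h1 : Tendsto (fun T : ℝ => Real.exp (-(μ * T))) atTop (𝓝 0) :=
    Real.tendsto_exp_neg_atTop_nhds_zero.comp (tendsto_id.const_mul_atTop hμ0)
  have h2 : Tendsto (fun T : ℝ => Real.exp (-T - a)) atTop (𝓝 0) :=
    Real.tendsto_exp_atBot.comp (tendsto_atBot_add_const_right _ _ tendsto_neg_atTop_atBot)
  have h3 : Tendsto (fun T : ℝ => (1 / (1 - Real.exp (-(μ * T))) + 1) *
        (Real.exp (-T - a) / (1 - Real.exp (-T - a))) * |Real.pi - -Real.pi|) atTop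
        (𝓝 ((1 / (1 - 0) + 1) * (0 / (1 - 0)) * |Real.pi - -Real.pi|)) :=
    ((((tendsto_const_nhds.div (h1.const_sub 1) (by norm_num)).add_const 1)).mul
      (h2.div (h2.const_sub 1) (by norm_num))).mul_const _
  rw [zero_div, mul_zero, zero_mul] at h3
  refine squeeze_zero_norm' ?_ h3
  filter_upwards [eventually_gt_atTop 0, eventually_gt_atTop (-a)] with T hT0 hTa
  refine intervalIntegral.norm_integral_le_of_norm_le_const fun y hy => ?_
  rw [Set.uIoc_of_le (by linarith)] at hy
  exact norm_stripKernel_left_le hμ0 hμ1 hT0 hTa (abs_le.2 ⟨hy.1.le, hy.2⟩)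

theorem continuousOn_stripKernel_vertical {μ : ℝ} (hμ0 : 0 < μ) (hμ1 : μ < 1) (a T : ℝ) :
    ContinuousOn (fun y : ℝ => stripKernel μ a (T + y * Complex.I))
      (Set.uIcc (-Real.pi) Real.pi) := by
  intro y hy
  rw [Set.uIcc_of_le (by linarith [Real.pi_pos])] at hy
  have h : ContinuousAt (stripKernel μ a) ((T : ℂ) + y * Complex.I) :=
    (differentiableAt_stripKernel hμ0 hμ1 (by simpa using abs_le.2 ⟨hy.1, hy.2⟩)).continuousAt
  exact (ContinuousAt.comp (f := fun y : ℝ => (T : ℂ) + y * Complex.I) h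
    (by fun_prop)).continuousWithinAt

theorem tendsto_integral_stripKernel_right {μ : ℝ} (hμ0 : 0 < μ) (hμ1 : μ < 1) (a : ℝ) :
    Tendsto (fun T : ℝ => ∫ y : ℝ in (-Real.pi)..Real.pi,
      stripKernel μ a (T + y * Complex.I)) atTop
      (𝓝 (-(2 * Real.pi * (1 / (1 + Complex.exp (μ * a)))))) := by
  have hpi := Real.pi_pos
  have h1 : Tendsto (fun T : ℝ => Real.exp (-(μ * T))) atTop (𝓝 0) :=
    Real.tendsto_exp_neg_atTop_nhds_zero.comp (tendsto_id.const_mul_atTop hμ0)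
  have h2 : Tendsto (fun T : ℝ => Real.exp (a - T)) atTop (𝓝 0) :=
    Real.tendsto_exp_atBot.comp (tendsto_const_nhds.add_atBot tendsto_neg_atTop_atBot |>.congr
      fun T => (sub_eq_add_neg a T).symm)
  have h3 : Tendsto (fun T : ℝ =>
      (Real.exp (-(μ * T)) / (1 - Real.exp (-(μ * T))) * (1 / (1 - Real.exp (a - T))) +
        Real.exp (a - T) / (1 - Real.exp (a - T))) * |Real.pi - -Real.pi|) atTop
        (𝓝 ((0 / (1 - 0) * (1 / (1 - 0)) + 0 / (1 - 0)) * |Real.pi - -Real.pi|)) :=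
    (((h1.div (h1.const_sub 1) (by norm_num)).mul
      (tendsto_const_nhds.div (h2.const_sub 1) (by norm_num))).add
      (h2.div (h2.const_sub 1) (by norm_num))).mul_const _
  rw [zero_div, zero_mul, zero_add, zero_mul] at h3
  rw [tendsto_iff_norm_sub_tendsto_zero]
  refine squeeze_zero_norm' ?_ h3
  filter_upwards [eventually_gt_atTop 0, eventually_gt_atTop a] with T hT0 hTa
  have e : (∫ y : ℝ in (-Real.pi)..Real.pi, stripKernel μ a (T + y * Complex.I)) -
      (-(2 * Real.pi * (1 / (1 + Complex.exp (μ * a))))) =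
      ∫ y : ℝ in (-Real.pi)..Real.pi,
        (stripKernel μ a (T + y * Complex.I) + 1 / (1 + Complex.exp (μ * a))) := by
    rw [intervalIntegral.integral_add
      (continuousOn_stripKernel_vertical hμ0 hμ1 a T).intervalIntegrable
      intervalIntegrable_const, intervalIntegral.integral_const, Complex.real_smul]
    push_cast
    ring
  rw [e, norm_norm]
  refine intervalIntegral.norm_integral_le_of_norm_le_const fun y hy => ?_
  rw [Set.uIoc_of_le (by linarith)] at hy
  exact norm_stripKernel_add_right_le hμ0 hμ1 hT0 hTa (abs_le.2 ⟨hy.1.le, hy.2⟩)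

/-! ### Cauchy's theorem and the value of the integral. -/

theorem integral_logKernel_interval {μ : ℝ} (hμ0 : 0 < μ) (hμ1 : μ < 1) (a T : ℝ) :
    2 * Complex.I * Real.sin (Real.pi * μ) * ((∫ u in (-T)..T, logKernel μ a u : ℝ) : ℂ) =
      Complex.I * (∫ y : ℝ in (-Real.pi)..Real.pi,
        stripKernel μ a ((-T : ℝ) + y * Complex.I)) -
      Complex.I * ∫ y : ℝ in (-Real.pi)..Real.pi, stripKernel μ a (T + y * Complex.I) := by
  have hpi := Real.pi_pos
  have h := Complex.integral_boundary_rect_eq_zero_of_differentiableOn (stripKernel μ a)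
    (⟨-T, -Real.pi⟩ : ℂ) (⟨T, Real.pi⟩ : ℂ) (by
      intro w hw
      have hw2 := hw.2
      simp only [Set.mem_preimage, Set.uIcc_of_le (by linarith : -Real.pi ≤ Real.pi)] at hw2
      exact (differentiableAt_stripKernel hμ0 hμ1
        (abs_le.2 ⟨hw2.1, hw2.2⟩)).differentiableWithinAt)
  simp only [smul_eq_mul] at h
  have hcont : ∀ c : ℝ, |c| ≤ Real.pi → IntervalIntegrable
      (fun u : ℝ => stripKernel μ a (u + c * Complex.I)) volume (-T) T := by
    intro c hc
    refine Continuous.intervalIntegrable (continuous_iff_continuousAt.2 fun u => ?_) _ _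
    have h : ContinuousAt (stripKernel μ a) ((u : ℂ) + c * Complex.I) :=
      (differentiableAt_stripKernel hμ0 hμ1 (by simpa using hc)).continuousAt
    exact ContinuousAt.comp (f := fun u : ℝ => (u : ℂ) + c * Complex.I) h (by fun_prop)
  rw [← intervalIntegral.integral_sub (hcont _ (by simp [abs_of_pos hpi]))
    (hcont _ (by simp [abs_of_pos hpi]))] at h
  simp only [stripKernel_sub hμ0 hμ1] at h
  rw [intervalIntegral.integral_const_mul, intervalIntegral.integral_ofReal] at h
  linear_combination h

theorem logKernel_integral {μ : ℝ} (hμ0 : 0 < μ) (hμ1 : μ < 1) (a : ℝ) :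
    Integrable (logKernel μ a) ∧
    Real.sin (Real.pi * μ) / Real.pi * ∫ u, logKernel μ a u = 1 / (1 + Real.exp (μ * a)) := by
  have hpi := Real.pi_pos
  have hs : 0 < Real.sin (Real.pi * μ) :=
    Real.sin_pos_of_pos_of_lt_pi (by positivity) (by nlinarith)
  have hlim : Tendsto (fun T : ℝ => ∫ u in (-T)..T, logKernel μ a u) atTop
      (𝓝 (Real.pi / Real.sin (Real.pi * μ) * (1 / (1 + Real.exp (μ * a))))) := by
    have h1 := (((tendsto_integral_stripKernel_left hμ0 hμ1 a).const_mul Complex.I).sub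
      ((tendsto_integral_stripKernel_right hμ0 hμ1 a).const_mul Complex.I)).const_mul
      (1 / (2 * Complex.I * Real.sin (Real.pi * μ)))
    have hs' : ((Real.sin (Real.pi * μ) : ℝ) : ℂ) ≠ 0 := Complex.ofReal_ne_zero.2 hs.ne'
    have h2 : Tendsto (fun T : ℝ => ((∫ u in (-T)..T, logKernel μ a u : ℝ) : ℂ)) atTop
        (𝓝 (((Real.pi / Real.sin (Real.pi * μ) * (1 / (1 + Real.exp (μ * a))) : ℝ)) : ℂ)) := by
      convert h1.congr' ?_ using 2
      · push_cast at hs' ⊢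
        field_simp
        ring
      · filter_upwards with T
        rw [← integral_logKernel_interval hμ0 hμ1 a T]
        field_simp
    have h3 := (Complex.continuous_re.tendsto _).comp h2
    simpa only [Function.comp_def, Complex.ofReal_re] using h3
  -- The integrand is nonnegative, so convergence of the symmetric integrals already gives
  -- integrability.
  have hint : Integrable (logKernel μ a) := by
    refine integrable_of_intervalIntegral_norm_tendsto (l := atTop) (a := fun T : ℝ => -T)
      (b := fun T : ℝ => T) (I := Real.pi / Real.sin (Real.pi * μ) * (1 / (1 + Real.exp (μ * a))))
      (fun T => (continuous_logKernel hμ0 hμ1 a).integrableOn_Ioc) tendsto_neg_atTop_atBot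
      tendsto_id ?_
    simpa only [Real.norm_of_nonneg (logKernel_nonneg hμ0 hμ1 a _)] using hlim
  refine ⟨hint, ?_⟩
  rw [tendsto_nhds_unique (intervalIntegral_tendsto_integral hint tendsto_neg_atTop_atBot
    tendsto_id) hlim]
  field_simp

/-! ### Uniqueness for the Stieltjes transform on the unit interval. -/

theorem norm_pow_mul_inv_one_sub_le {w z : ℝ} (hw : |w| < 1 / 2) (hz : z ∈ Set.Icc (0 : ℝ) 1)
    (k : ℕ) : ‖z ^ k * (1 - w * z)⁻¹‖ ≤ 2 := by
  obtain ⟨hw1, hw2⟩ := abs_lt.1 hw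
  have h1 : 1 / 2 ≤ 1 - w * z := by nlinarith [hz.1, hz.2]
  have h2 : (1 - w * z)⁻¹ ≤ 2 := by
    rw [inv_le_comm₀ (by linarith) (by norm_num)]; linarith
  have h3 : 0 ≤ (1 - w * z)⁻¹ := inv_nonneg.2 (by linarith)
  have h4 : z ^ k ≤ 1 := pow_le_one₀ hz.1 hz.2
  have h5 : 0 ≤ z ^ k := pow_nonneg hz.1 k
  rw [Real.norm_of_nonneg (mul_nonneg h5 h3)]
  nlinarith

section Moments

variable {ν : Measure ℝ} [IsFiniteMeasure ν]

theorem integrable_pow_mul_inv_one_sub (hν : ∀ᵐ z ∂ν, z ∈ Set.Icc (0 : ℝ) 1) {w : ℝ}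
    (hw : |w| < 1 / 2) (k : ℕ) : Integrable (fun z => z ^ k * (1 - w * z)⁻¹) ν := by
  refine Integrable.of_bound (by fun_prop) 2 ?_
  filter_upwards [hν] with z hz using norm_pow_mul_inv_one_sub_le hw hz k

theorem continuousAt_integral_pow_mul_inv_one_sub (hν : ∀ᵐ z ∂ν, z ∈ Set.Icc (0 : ℝ) 1) (k : ℕ) :
    ContinuousAt (fun w : ℝ => ∫ z, z ^ k * (1 - w * z)⁻¹ ∂ν) 0 := by
  refine continuousAt_of_dominated (bound := fun _ => 2) ?_ ?_ (integrable_const _) ?_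
  · exact Eventually.of_forall fun w => by fun_prop
  · have : ∀ᶠ w : ℝ in 𝓝 0, |w| < 1 / 2 :=
      (continuous_abs.tendsto 0).eventually_lt_const (by norm_num)
    filter_upwards [this] with w hw
    filter_upwards [hν] with z hz using norm_pow_mul_inv_one_sub_le hw hz k
  · refine Eventually.of_forall fun z => ?_
    exact ContinuousAt.mul (by fun_prop) (ContinuousAt.inv₀ (by fun_prop) (by simp))

/-- Integrates w z / (1 - w z) = 1 / (1 - w z) - 1 against z^k. The k-th moment is written as the
transform at w = 0 so that the recursion stays within one family of functions. -/
theorem mul_integral_pow_succ_mul_inv_one_sub (hν : ∀ᵐ z ∂ν, z ∈ Set.Icc (0 : ℝ) 1) {w : ℝ}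
    (hw : |w| < 1 / 2) (k : ℕ) : w * ∫ z, z ^ (k + 1) * (1 - w * z)⁻¹ ∂ν =
      (∫ z, z ^ k * (1 - w * z)⁻¹ ∂ν) - ∫ z, z ^ k * (1 - 0 * z)⁻¹ ∂ν := by
  rw [← integral_const_mul, ← integral_sub (integrable_pow_mul_inv_one_sub hν hw k)
    (integrable_pow_mul_inv_one_sub hν (by norm_num) k)]
  refine integral_congr_ae ?_
  filter_upwards [hν] with z hz
  obtain ⟨hw1, hw2⟩ := abs_lt.1 hw
  have h1 : 1 - w * z ≠ 0 := by nlinarith [hz.1, hz.2]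
  field_simp
  ring

end Moments

/-- The recursion in k determines the next transform for w ≠ 0 after division by w; continuity at 0
fills in w = 0. Evaluation at w = 0 then yields the moments. -/
theorem integral_pow_mul_inv_one_sub_congr {ν ρ : Measure ℝ} [IsFiniteMeasure ν]
    [IsFiniteMeasure ρ] (hν : ∀ᵐ z ∂ν, z ∈ Set.Icc (0 : ℝ) 1)
    (hρ : ∀ᵐ z ∂ρ, z ∈ Set.Icc (0 : ℝ) 1)
    (h : ∀ w : ℝ, |w| < 1 / 2 → ∫ z, (1 - w * z)⁻¹ ∂ν = ∫ z, (1 - w * z)⁻¹ ∂ρ) (k : ℕ) :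
    ∀ w : ℝ, |w| < 1 / 2 →
      ∫ z, z ^ k * (1 - w * z)⁻¹ ∂ν = ∫ z, z ^ k * (1 - w * z)⁻¹ ∂ρ := by
  induction k with
  | zero => simpa using h
  | succ k ih =>
    have hne : ∀ w : ℝ, |w| < 1 / 2 → w ≠ 0 →
        ∫ z, z ^ (k + 1) * (1 - w * z)⁻¹ ∂ν = ∫ z, z ^ (k + 1) * (1 - w * z)⁻¹ ∂ρ := by
      intro w hw hw0
      apply mul_left_cancel₀ hw0
      rw [mul_integral_pow_succ_mul_inv_one_sub hν hw, mul_integral_pow_succ_mul_inv_one_sub hρ hw,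
        ih w hw, ih 0 (by norm_num)]
    intro w hw
    by_cases hw0 : w = 0
    · subst hw0
      have h1 := (continuousAt_integral_pow_mul_inv_one_sub hν (k + 1)).tendsto.mono_left
        (nhdsWithin_le_nhds (s := {0}ᶜ))
      have h2 := (continuousAt_integral_pow_mul_inv_one_sub hρ (k + 1)).tendsto.mono_left
        (nhdsWithin_le_nhds (s := {0}ᶜ))
      refine tendsto_nhds_unique (h1.congr' ?_) h2
      have : ∀ᶠ w : ℝ in 𝓝[≠] 0, |w| < 1 / 2 :=
        nhdsWithin_le_nhds ((continuous_abs.tendsto 0).eventually_lt_const (by norm_num))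
      filter_upwards [this, self_mem_nhdsWithin] with w hw hw0 using hne w hw hw0
    · exact hne w hw hw0

/-- Finite measures on the unit interval are determined by their moments. -/
theorem ext_of_integral_pow_eq {ν ρ : Measure ℝ} [IsFiniteMeasure ν]
    [IsFiniteMeasure ρ] (hν : ∀ᵐ z ∂ν, z ∈ Set.Icc (0 : ℝ) 1)
    (hρ : ∀ᵐ z ∂ρ, z ∈ Set.Icc (0 : ℝ) 1)
    (h : ∀ k : ℕ, ∫ z, z ^ k ∂ν = ∫ z, z ^ k ∂ρ) : ν = ρ := by
  have hint : ∀ (m : Measure ℝ) [IsFiniteMeasure m], (∀ᵐ z ∂m, z ∈ Set.Icc (0 : ℝ) 1) →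
      ∀ k : ℕ, Integrable (fun z : ℝ => z ^ k) m := by
    intro m _ hm k
    simpa using integrable_pow_mul_inv_one_sub hm (w := 0) (by norm_num) k
  have hpi : ∀ (m : Measure ℝ) [IsFiniteMeasure m], (∀ᵐ z ∂m, z ∈ Set.Icc (0 : ℝ) 1) →
      ∀ p : Polynomial ℝ, Integrable (fun z : ℝ => p.eval z) m := by
    intro m _ hm p
    simp only [Polynomial.eval_eq_sum_range]
    exact integrable_finsetSum _ fun i _ => (hint m hm i).const_mul _
  have hp : ∀ p : Polynomial ℝ, ∫ z, p.eval z ∂ν = ∫ z, p.eval z ∂ρ := by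
    intro p
    simp only [Polynomial.eval_eq_sum_range]
    rw [integral_finsetSum _ fun i _ => (hint ν hν i).const_mul _,
      integral_finsetSum _ fun i _ => (hint ρ hρ i).const_mul _]
    simp only [integral_const_mul, h]
  refine ext_of_forall_integral_eq_of_IsFiniteMeasure fun f => ?_
  have hb : ∀ (m : Measure ℝ) [IsFiniteMeasure m], (∀ᵐ z ∂m, z ∈ Set.Icc (0 : ℝ) 1) →
      ∀ (ε : ℝ) (p : Polynomial ℝ), (∀ x ∈ Set.Icc (0 : ℝ) 1, |p.eval x - f x| < ε) →
      |∫ z, p.eval z ∂m - ∫ z, f z ∂m| ≤ ε * m.real Set.univ := by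
    intro m _ hm ε p hpε
    rw [← integral_sub (hpi m hm p) (f.integrable m), ← Real.norm_eq_abs]
    refine norm_integral_le_of_norm_le_const ?_
    filter_upwards [hm] with z hz using (hpε z hz).le
  have hε : ∀ ε : ℝ, 0 < ε →
      |∫ z, f z ∂ν - ∫ z, f z ∂ρ| ≤ ε * (ν.real Set.univ + ρ.real Set.univ) := by
    intro ε hε
    -- Weierstrass approximation on [0,1]: each integral of f differs from that of p by at most ε
    -- times the total mass.
    obtain ⟨p, hpε⟩ := exists_polynomial_near_of_continuousOn 0 1 f f.continuous.continuousOn ε hε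
    have h1 := hb ν hν ε p hpε
    have h2 := hb ρ hρ ε p hpε
    rw [hp p] at h1
    rw [abs_le] at h1 h2 ⊢
    constructor <;> linarith [h1.1, h1.2, h2.1, h2.2]
  have hlim : Tendsto (fun ε : ℝ => ε * (ν.real Set.univ + ρ.real Set.univ)) (𝓝[>] 0) (𝓝 0) := by
    have : Tendsto (fun ε : ℝ => ε * (ν.real Set.univ + ρ.real Set.univ)) (𝓝 0)
        (𝓝 (0 * (ν.real Set.univ + ρ.real Set.univ))) := tendsto_id.mul_const _
    rw [zero_mul] at this
    exact this.mono_left nhdsWithin_le_nhds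
  have h0 : |∫ z, f z ∂ν - ∫ z, f z ∂ρ| ≤ 0 :=
    ge_of_tendsto hlim (by filter_upwards [self_mem_nhdsWithin] with ε h using hε ε h)
  exact sub_eq_zero.1 (abs_nonpos_iff.1 h0)

/-- Finite measures on the unit interval are determined by their Stieltjes transform near `0`. -/
theorem ext_of_integral_inv_one_sub_eq {ν ρ : Measure ℝ} [IsFiniteMeasure ν]
    [IsFiniteMeasure ρ] (hν : ∀ᵐ z ∂ν, z ∈ Set.Icc (0 : ℝ) 1)
    (hρ : ∀ᵐ z ∂ρ, z ∈ Set.Icc (0 : ℝ) 1)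
    (h : ∀ w : ℝ, |w| < 1 / 2 → ∫ z, (1 - w * z)⁻¹ ∂ν = ∫ z, (1 - w * z)⁻¹ ∂ρ) : ν = ρ :=
  ext_of_integral_pow_eq hν hρ fun k => by
    simpa using integral_pow_mul_inv_one_sub_congr hν hρ h k 0 (by norm_num)

/-! ### The Stieltjes transform of the ratio of stable variables. -/

namespace IsPositiveStable

variable {Ω : Type*} [MeasurableSpace Ω] {P : Measure Ω} [IsProbabilityMeasure P] {μ : ℝ}
  {S S' : Ω → ℝ}

theorem integrable_exp (h : IsPositiveStable P μ S) {t : ℝ} (ht : 0 ≤ t) :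
    Integrable (fun ω => Real.exp (-(t * S ω))) P := by
  have := h.aemeasurable
  refine Integrable.of_bound (by fun_prop) 1 ?_
  filter_upwards [h.nonneg] with ω hω
  rw [Real.norm_of_nonneg (Real.exp_pos _).le, Real.exp_le_one_iff]
  have := mul_nonneg ht hω
  linarith

/-- Markov-type bound: exp(-tS) ≥ 1 where S ≤ 0, so that event has probability at most exp(-t^μ),
which tends to 0. -/
theorem ae_pos (h : IsPositiveStable P μ S) (hμ0 : 0 < μ) : ∀ᵐ ω ∂P, 0 < S ω := by
  have hle : ∀ t : ℝ, 0 ≤ t → P.real {ω | S ω ≤ 0} ≤ Real.exp (-(t ^ μ)) := by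
    intro t ht
    rw [← h.laplace t ht]
    have hn : NullMeasurableSet {ω | S ω ≤ 0} P :=
      h.aemeasurable.nullMeasurable measurableSet_Iic
    have e : P.real {ω | S ω ≤ 0} = ∫ ω, {ω | S ω ≤ 0}.indicator (fun _ => (1 : ℝ)) ω ∂P := by
      rw [integral_indicator₀ hn]; simp
    rw [e]
    refine integral_mono_ae ((integrable_const _).indicator₀ hn) (h.integrable_exp ht) ?_
    refine Eventually.of_forall fun ω => ?_
    by_cases hω : S ω ≤ 0
    · simp only [Set.indicator, Set.mem_ofPred_eq, hω, if_true]
      apply Real.one_le_exp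
      nlinarith
    · simp only [Set.indicator, Set.mem_ofPred_eq, hω, if_false]
      positivity
  have hlim : Tendsto (fun t : ℝ => Real.exp (-(t ^ μ))) atTop (𝓝 0) :=
    Real.tendsto_exp_neg_atTop_nhds_zero.comp (tendsto_rpow_atTop hμ0)
  have h0 : P.real {ω | S ω ≤ 0} ≤ 0 :=
    ge_of_tendsto hlim (by filter_upwards [eventually_ge_atTop 0] with t ht using hle t ht)
  have h1 : P {ω | S ω ≤ 0} = 0 := by
    have := le_antisymm h0 measureReal_nonneg
    rwa [measureReal_eq_zero_iff] at this
  rw [ae_iff]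
  simpa using h1

/-- Differentiation of the Laplace transform, read as the moment generating function at -t, an
interior point of its domain. -/
theorem integral_mul_exp (h : IsPositiveStable P μ S) {t : ℝ} (ht : 0 < t) :
    Integrable (fun ω => S ω * Real.exp (-(t * S ω))) P ∧
    ∫ ω, S ω * Real.exp (-(t * S ω)) ∂P = μ * t ^ (μ - 1) * Real.exp (-(t ^ μ)) := by
  have hsub : Set.Iic (0 : ℝ) ⊆ integrableExpSet S P := by
    intro s hs
    simpa [integrableExpSet] using h.integrable_exp (t := -s) (by simpa using hs)
  have hint : -t ∈ interior (integrableExpSet S P) :=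
    interior_mono hsub (by rw [interior_Iic]; simpa using ht)
  have hd := hasDerivAt_mgf hint
  have hd2 : HasDerivAt (fun s : ℝ => Real.exp (-((-s) ^ μ)))
      (Real.exp (-((- -t) ^ μ)) * -(-1 * μ * (- -t) ^ (μ - 1))) (-t) :=
    (((hasDerivAt_neg (-t)).rpow_const (Or.inl (by simpa using ht.ne'))).neg).exp
  have heq : mgf S P =ᶠ[𝓝 (-t)] fun s : ℝ => Real.exp (-((-s) ^ μ)) := by
    filter_upwards [Iio_mem_nhds (show -t < 0 by linarith)] with s hs
    rw [← h.laplace (-s) (by have : s < 0 := hs; linarith)]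
    simp [mgf]
  have he := hd.unique (hd2.congr_of_eventuallyEq heq)
  constructor
  · have := integrable_pow_mul_exp_of_mem_interior_integrableExpSet hint 1
    simpa using this
  · simp only [neg_neg, neg_mul] at he
    rw [he]
    ring

theorem integral_mul_exp_add (h : IsPositiveStable P μ S) (h' : IsPositiveStable P μ S')
    (hind : IndepFun S S' P) {x t : ℝ} (hx : 0 ≤ x) (ht : 0 < t) :
    Integrable (fun ω => S ω * Real.exp (-(t * (S ω + x * S' ω)))) P ∧
    ∫ ω, S ω * Real.exp (-(t * (S ω + x * S' ω))) ∂P =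
      μ * t ^ (μ - 1) * Real.exp (-(1 + x ^ μ) * t ^ μ) := by
  have e : (fun ω => S ω * Real.exp (-(t * (S ω + x * S' ω)))) =
      fun ω => (S ω * Real.exp (-(t * S ω))) * Real.exp (-((t * x) * S' ω)) := by
    ext ω
    rw [mul_assoc, ← Real.exp_add]
    ring_nf
  have hi : IndepFun (fun ω => S ω * Real.exp (-(t * S ω)))
      (fun ω => Real.exp (-((t * x) * S' ω))) P :=
    hind.comp (φ := fun s => s * Real.exp (-(t * s)))
      (ψ := fun s => Real.exp (-((t * x) * s))) (by fun_prop) (by fun_prop)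
  have h1 := h.integral_mul_exp ht
  have htx : 0 ≤ t * x := by positivity
  have h2 := h'.integrable_exp htx
  rw [e]
  refine ⟨hi.integrable_mul h1.1 h2, ?_⟩
  rw [hi.integral_fun_mul_eq_mul_integral h1.1.aestronglyMeasurable h2.aestronglyMeasurable,
    h1.2, h'.laplace _ htx, mul_assoc, ← Real.exp_add, Real.mul_rpow ht.le hx]
  ring_nf

theorem integral_rpow_mul_exp {c : ℝ} (hμ0 : 0 < μ) (hc : 0 < c) :
    ∫ t in Set.Ioi (0 : ℝ), μ * t ^ (μ - 1) * Real.exp (-c * t ^ μ) = 1 / c := by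
  simp only [mul_assoc]
  rw [integral_const_mul, integral_rpow_mul_exp_neg_mul_rpow hμ0 (by linarith) hc]
  have : (μ - 1 + 1) / μ = 1 := by field_simp; ring
  rw [neg_div, this, Real.Gamma_one, Real.rpow_neg_one]
  field_simp

/-- The Stieltjes transform of the ratio of two independent stable variables. -/
theorem integral_div_add (h : IsPositiveStable P μ S) (h' : IsPositiveStable P μ S')
    (hind : IndepFun S S' P) (hμ0 : 0 < μ) {x : ℝ} (hx : 0 ≤ x) :
    ∫ ω, S ω / (S ω + x * S' ω) ∂P = 1 / (1 + x ^ μ) := by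
  have hxμ : 0 ≤ x ^ μ := Real.rpow_nonneg hx μ
  have hm := h.aemeasurable
  have hm' := h'.aemeasurable
  set F : ℝ → Ω → ℝ := fun t ω => S ω * Real.exp (-(t * (S ω + x * S' ω))) with hF
  have hval : ∫ t in Set.Ioi (0 : ℝ), ∫ ω, F t ω ∂P = 1 / (1 + x ^ μ) := by
    rw [← integral_rpow_mul_exp hμ0 (show 0 < 1 + x ^ μ by linarith)]
    exact setIntegral_congr_fun measurableSet_Ioi fun t ht =>
      (h.integral_mul_exp_add h' hind hx ht).2
  have hmeas : AEStronglyMeasurable (Function.uncurry F)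
      ((volume.restrict (Set.Ioi (0 : ℝ))).prod P) := by
    have m1 : AEMeasurable (fun p : ℝ × Ω => S p.2) ((volume.restrict (Set.Ioi (0 : ℝ))).prod P) :=
      hm.comp_snd
    have m2 : AEMeasurable (fun p : ℝ × Ω => S' p.2) ((volume.restrict (Set.Ioi (0 : ℝ))).prod P) :=
      hm'.comp_snd
    have : AEMeasurable (Function.uncurry F) ((volume.restrict (Set.Ioi (0 : ℝ))).prod P) := by
      simp only [Function.uncurry_def, hF]
      fun_prop
    exact this.aestronglyMeasurable
  have hint : Integrable (Function.uncurry F) ((volume.restrict (Set.Ioi (0 : ℝ))).prod P) := by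
    rw [integrable_prod_iff hmeas]
    constructor
    · filter_upwards [ae_restrict_mem measurableSet_Ioi] with t ht
      exact (h.integral_mul_exp_add h' hind hx ht).1
    · have : ∀ t, ∫ ω, ‖Function.uncurry F (t, ω)‖ ∂P = ∫ ω, F t ω ∂P := fun t =>
        integral_congr_ae (by
          filter_upwards [h.nonneg] with ω hω
          exact Real.norm_of_nonneg (mul_nonneg hω (Real.exp_pos _).le))
      simp only [this]
      -- A non-integrable function has Bochner integral 0 by convention, so the positive value
      -- `hval` forces integrability.
      refine Integrable.of_integral_ne_zero ?_
      rw [hval]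
      positivity
  rw [← hval, integral_integral_swap hint]
  refine integral_congr_ae ?_
  filter_upwards [h.ae_pos hμ0, h'.nonneg] with ω hω hω'
  have hpos : 0 < S ω + x * S' ω := by positivity
  simp only [hF]
  rw [integral_const_mul]
  have e : ∀ t : ℝ, Real.exp (-(t * (S ω + x * S' ω))) =
      Real.exp (-(S ω + x * S' ω) * t) := fun t => by ring_nf
  simp only [e]
  rw [integral_exp_mul_Ioi (by linarith)]
  simp only [mul_zero, Real.exp_zero]
  field_simp

end IsPositiveStable

/-! ### The Stieltjes transform of the density. -/

theorem stableRatioDensity_nonneg {μ : ℝ} (hμ0 : 0 < μ) (hμ1 : μ < 1) {z : ℝ}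
    (hz : z ∈ Set.Icc (0 : ℝ) 1) : 0 ≤ stableRatioDensity μ z := by
  have hpi := Real.pi_pos
  have hs : 0 < Real.sin (Real.pi * μ) :=
    Real.sin_pos_of_pos_of_lt_pi (by positivity) (by nlinarith)
  -- At both endpoints z (1 - z) = 0, and division by zero makes the density 0.
  rcases hz.1.eq_or_lt with rfl | h0
  · simp [stableRatioDensity]
  rcases hz.2.eq_or_lt with rfl | h1
  · simp [stableRatioDensity]
  have h1' : 0 < 1 - z := by linarith
  have hr : 0 < (z / (1 - z)) ^ μ := by positivity
  have h := inv_add_self_add_two_cos_pos hμ0 hμ1 hr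
  rw [← Real.inv_rpow (by positivity), inv_div] at h
  unfold stableRatioDensity
  positivity

theorem sigmoid_div_one_sub_sigmoid (v : ℝ) :
    Real.sigmoid v / (1 - Real.sigmoid v) = Real.exp v := by
  have := Real.exp_pos v
  rw [Real.sigmoid_def, Real.exp_neg]
  field_simp
  ring

/-- For z = sigmoid v the Jacobian z (1 - z) cancels the same factor in the density. Dividing (1 -
z) / (1 - w z) through by z gives e^(-v) / (e^(-v) + 1 - w), whence e^a = 1 - w and u = -v. -/
theorem sigmoid_smul_stableRatioDensity (μ : ℝ) {w : ℝ} (hw : w < 1) (v : ℝ) :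
    |Real.sigmoid v * (1 - Real.sigmoid v)| •
      (stableRatioDensity μ (Real.sigmoid v) * (1 - Real.sigmoid v) *
        (1 - w * Real.sigmoid v)⁻¹) =
      Real.sin (Real.pi * μ) / Real.pi * logKernel μ (Real.log (1 - w)) (-v) := by
  have h0 := Real.sigmoid_pos v
  have h1 : 0 < 1 - Real.sigmoid v := by linarith [Real.sigmoid_lt_one v]
  have hr := sigmoid_div_one_sub_sigmoid v
  have e1 : (Real.sigmoid v / (1 - Real.sigmoid v)) ^ μ = (Real.exp (μ * -v))⁻¹ := by
    rw [hr, ← Real.exp_mul, ← Real.exp_neg]; ring_nf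
  have e2 : ((1 - Real.sigmoid v) / Real.sigmoid v) ^ μ = Real.exp (μ * -v) := by
    rw [← inv_div, Real.inv_rpow (by positivity), e1, inv_inv]
  have e3 : (1 - Real.sigmoid v) * (1 - w * Real.sigmoid v)⁻¹ =
      Real.exp (-v) / (Real.exp (-v) + Real.exp (Real.log (1 - w))) := by
    rw [Real.exp_log (by linarith), Real.exp_neg, ← hr]
    have : ((1 - Real.sigmoid v) / Real.sigmoid v) + (1 - w) =
        (1 - w * Real.sigmoid v) / Real.sigmoid v := by
      field_simp
      ring
    rw [inv_div, this, div_div_div_cancel_right₀ h0.ne', div_eq_mul_inv]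
  rw [abs_of_pos (mul_pos h0 h1), smul_eq_mul, stableRatioDensity, e1, e2, logKernel, ← e3,
    add_comm (Real.exp (μ * -v))]
  simp only [one_div, mul_inv]
  field_simp

theorem image_sigmoid_univ : Real.sigmoid '' Set.univ = Set.Ioo 0 1 := by
  rw [Set.image_univ, Real.range_sigmoid]

theorem integral_stableRatioDensity_mul {μ : ℝ} (hμ0 : 0 < μ) (hμ1 : μ < 1) {w : ℝ} (hw : w < 1) :
    IntegrableOn (fun z => stableRatioDensity μ z * (1 - z) * (1 - w * z)⁻¹) (Set.Icc 0 1) ∧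
    ∫ z in Set.Icc (0 : ℝ) 1, stableRatioDensity μ z * (1 - z) * (1 - w * z)⁻¹ =
      1 / (1 + (1 - w) ^ μ) := by
  have hd : ∀ v ∈ Set.univ, HasDerivWithinAt Real.sigmoid
      (Real.sigmoid v * (1 - Real.sigmoid v)) Set.univ v :=
    fun v _ => (Real.hasDerivAt_sigmoid v).hasDerivWithinAt
  obtain ⟨h1, h2⟩ := logKernel_integral hμ0 hμ1 (Real.log (1 - w))
  constructor
  · rw [integrableOn_Icc_iff_integrableOn_Ioo, ← image_sigmoid_univ,
      integrableOn_image_iff_integrableOn_abs_deriv_smul MeasurableSet.univ hd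
        Real.sigmoid_injective.injOn]
    simp only [sigmoid_smul_stableRatioDensity μ hw, integrableOn_univ]
    exact h1.comp_neg.const_mul _
  · rw [integral_Icc_eq_integral_Ioo, ← image_sigmoid_univ,
      integral_image_eq_integral_abs_deriv_smul MeasurableSet.univ hd
        Real.sigmoid_injective.injOn]
    simp only [sigmoid_smul_stableRatioDensity μ hw, Measure.restrict_univ]
    rw [integral_const_mul, integral_neg_eq_self (logKernel μ (Real.log (1 - w))), h2,
      Real.rpow_def_of_pos (by linarith), mul_comm μ]

/-! ### Identification of the law. -/

theorem measurable_stableRatioDensity (μ : ℝ) : Measurable (stableRatioDensity μ) := by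
  unfold stableRatioDensity
  fun_prop

theorem theorem2 {Ω : Type*} [MeasurableSpace Ω] (P : Measure Ω) [IsProbabilityMeasure P]
    (μ : ℝ) (hμ0 : 0 < μ) (hμ1 : μ < 1) (S S' : Ω → ℝ)
    (hS : IsPositiveStable P μ S) (hS' : IsPositiveStable P μ S') (hind : IndepFun S S' P) :
    (∀ z ∈ Set.Icc (0 : ℝ) 1, 0 ≤ stableRatioDensity μ z) ∧
    HasPDF (fun ω => S' ω / (S' ω + S ω)) P volume ∧
    pdf (fun ω => S' ω / (S' ω + S ω)) P volume =ᵐ[volume]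
      fun z => ENNReal.ofReal ((Set.Icc (0 : ℝ) 1).indicator (stableRatioDensity μ) z) := by
  have hnn : ∀ z ∈ Set.Icc (0 : ℝ) 1, 0 ≤ stableRatioDensity μ z := fun z hz =>
    stableRatioDensity_nonneg hμ0 hμ1 hz
  refine ⟨hnn, ?_⟩
  set A : Ω → ℝ := fun ω => S' ω / (S' ω + S ω) with hA
  set D : ℝ → ℝ := (Set.Icc (0 : ℝ) 1).indicator (stableRatioDensity μ) with hD
  have hD0 : ∀ z, 0 ≤ D z := Set.indicator_nonneg hnn
  have hDm : Measurable D := (measurable_stableRatioDensity μ).indicator measurableSet_Icc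
  have hAm : AEMeasurable A P := by
    have := hS.aemeasurable
    have := hS'.aemeasurable
    fun_prop
  have hAI : ∀ᵐ ω ∂P, A ω ∈ Set.Ico (0 : ℝ) 1 := by
    filter_upwards [hS.ae_pos hμ0, hS'.ae_pos hμ0] with ω h h'
    exact ⟨by positivity, (div_lt_one (by positivity)).2 (by linarith)⟩
  set ν : Measure ℝ := P.map A with hν
  set ρ : Measure ℝ := volume.withDensity fun z => ENNReal.ofReal (D z) with hρ
  have hνI : ∀ᵐ z ∂ν, z ∈ Set.Ico (0 : ℝ) 1 := (ae_map_iff hAm measurableSet_Ico).2 hAI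
  have hρI : ∀ᵐ z ∂ρ, z ∈ Set.Ico (0 : ℝ) 1 := by
    rw [hρ, ae_withDensity_iff (by fun_prop)]
    refine Eventually.of_forall fun z hz => ?_
    have hDz : D z ≠ 0 := fun h => hz (by rw [h, ENNReal.ofReal_zero])
    have hzI : z ∈ Set.Icc (0 : ℝ) 1 := Set.mem_of_indicator_ne_zero hDz
    refine ⟨hzI.1, lt_of_le_of_ne hzI.2 ?_⟩
    rintro rfl
    -- The density takes the default value 0 at z = 1, so the half-open interval carries the
    -- measure.
    exact hDz (by simp [hD, stableRatioDensity])
  -- The weight 1 - z matches the numerator S, as 1 - A = S / (S' + S). The total mass of `ρ` need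
  -- not be known beforehand: only the weighted measure has to be finite.
  set g : ℝ → ENNReal := fun z => ENNReal.ofReal (1 - z) with hg
  have hgm : Measurable g := by fun_prop
  have hρg : ρ.withDensity g = volume.withDensity fun z => ENNReal.ofReal (D z * (1 - z)) := by
    rw [hρ, ← withDensity_mul _ (by fun_prop) hgm]
    congr 1
    ext z
    exact (ENNReal.ofReal_mul (hD0 z)).symm
  have hDI : ∀ w z : ℝ, D z * (1 - z) * (1 - w * z)⁻¹ = (Set.Icc (0 : ℝ) 1).indicator
      (fun z => stableRatioDensity μ z * (1 - z) * (1 - w * z)⁻¹) z := by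
    intro w z
    by_cases hz : z ∈ Set.Icc (0 : ℝ) 1 <;> simp [hD, hz]
  have hρfin : IsFiniteMeasure (ρ.withDensity g) := by
    rw [hρg]
    refine isFiniteMeasure_withDensity_ofReal (Integrable.hasFiniteIntegral ?_)
    have h := (integral_stableRatioDensity_mul hμ0 hμ1 zero_lt_one).1.integrable_indicator
      measurableSet_Icc
    refine h.congr (Eventually.of_forall fun z => ?_)
    simp only [← hDI]
    simp
  have hνfin : IsFiniteMeasure (ν.withDensity g) := by
    have : IsProbabilityMeasure ν := Measure.isProbabilityMeasure_map hAm
    refine isFiniteMeasure_withDensity_ofReal (Integrable.hasFiniteIntegral ?_)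
    refine Integrable.of_bound (by fun_prop) 1 ?_
    filter_upwards [hνI] with z hz
    rw [Real.norm_of_nonneg (by linarith [hz.2])]
    linarith [hz.1]
  have heq : ν.withDensity g = ρ.withDensity g := by
    refine ext_of_integral_inv_one_sub_eq ?_ ?_ fun w hw => ?_
    · exact (withDensity_absolutelyContinuous _ _).ae_le
        (hνI.mono fun z hz => Set.Ico_subset_Icc_self hz)
    · exact (withDensity_absolutelyContinuous _ _).ae_le
        (hρI.mono fun z hz => Set.Ico_subset_Icc_self hz)
    have hw1 : w < 1 := by linarith [(abs_lt.1 hw).2]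
    have hl : ∫ z, (1 - w * z)⁻¹ ∂(ν.withDensity g) = 1 / (1 + (1 - w) ^ μ) := by
      rw [integral_withDensity_eq_integral_toReal_smul hgm (by simp [hg]), hν,
        integral_map hAm (by fun_prop),
        ← hS.integral_div_add hS' hind hμ0 (x := 1 - w) (by linarith)]
      refine integral_congr_ae ?_
      filter_upwards [hS.ae_pos hμ0, hS'.ae_pos hμ0, hAI] with ω h h' hAω
      rw [ENNReal.toReal_ofReal (by linarith [hAω.2]), smul_eq_mul]
      have h1 : 0 < S' ω + S ω := by positivity
      have h2 : 0 < S ω + (1 - w) * S' ω := by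
        have : 0 < 1 - w := by linarith
        positivity
      have e1 : 1 - A ω = S ω / (S' ω + S ω) := by
        simp only [hA]; field_simp; ring
      have e2 : 1 - w * A ω = (S ω + (1 - w) * S' ω) / (S' ω + S ω) := by
        simp only [hA]; field_simp; ring
      rw [e1, e2]
      field_simp
    have hr : ∫ z, (1 - w * z)⁻¹ ∂(ρ.withDensity g) = 1 / (1 + (1 - w) ^ μ) := by
      rw [hρg, integral_withDensity_eq_integral_toReal_smul (by fun_prop) (by simp),
        ← (integral_stableRatioDensity_mul hμ0 hμ1 hw1).2, ← integral_indicator measurableSet_Icc]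
      refine integral_congr_ae (Eventually.of_forall fun z => ?_)
      simp only [← hDI, smul_eq_mul]
      rw [ENNReal.toReal_ofReal]
      by_cases hz : z ∈ Set.Icc (0 : ℝ) 1
      · exact mul_nonneg (hD0 z) (by linarith [hz.2])
      · simp [hD, hz]
    rw [hl, hr]
  have hg0 : ∀ z ∈ Set.Ico (0 : ℝ) 1, g z ≠ 0 := fun z hz => by
    simpa [hg] using hz.2
  -- Both measures live on [0,1), where `g` is nonzero and finite, so multiplying by its inverse
  -- recovers them from the weighted ones.
  have hlaw : P.map A = volume.withDensity fun z => ENNReal.ofReal (D z) := by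
    rw [← hν, ← hρ, ← withDensity_inv_same hgm (hνI.mono hg0) (by simp [hg]), heq,
      withDensity_inv_same hgm (hρI.mono hg0) (by simp [hg])]
  have hDm' : AEMeasurable (fun z => ENNReal.ofReal (D z)) volume := by fun_prop
  have hpdf : HasPDF A P volume := hasPDF_of_map_eq_withDensity hAm _ hDm' hlaw
  exact ⟨hpdf, (pdf.eq_of_map_eq_withDensity _ hDm').1 hlaw⟩
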